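/- Let $X$, $Y$ be smooth manifolds of dimensions $m\ge 3$ and $n\ge 1$, let $g$, $h$ be smooth pseudo-Riemannian metrics (of arbitrary signature) on $X$ and $Y$, let $\phi:X\to Y$ be a smooth map, and let $\kappa\neq 0$ be a real constant. Let $\mathrm{Ric}$ be the Ricci tensor of $g$, let $\phi^*h=h(d\phi,d\phi)$, and let $\nabla d\phi$ be the second fundamental form of $\phi$, which in local coordinates has the components $$\nabla_a\partial_b\phi^k=\partial_a\partial_b\phi^k-{}^g\Gamma^c_{ab}\,\partial_c\phi^k+{}^h\Gamma^k_{ij}(\phi)\,\partial_a\phi^i\,\partial_b\phi^j ,$$ and let $\mathrm{tr}(\nabla d\phi)^k=g^{ab}\nabla_a\partial_b\phi^k$. (1) If the Einstein equation $\kappa\,\mathrm{Ric}=\phi^*h$ holds on $X$, then $h(\mathrm{tr}(\nabla d\phi),d\phi)=0$, i.e. $h(\mathrm{tr}(\nabla d\phi)_x,d\phi_x(v))=0$ for all $x\in X$ and $v\in T_xX$. (2) If $\phi$ is a submersion, i.e. $d\phi_x$ is surjective for every $x\in X$, then the equation $h(\mathrm{tr}(\nabla d\phi),d\phi)=0$ implies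 $\mathrm{tr}(\nabla d\phi)=0$. (3) Consequently, if $\phi$ is a submersion and $\kappa\,\mathrm{Ric}=\phi^*h$, then $\mathrm{tr}(\nabla d\phi)=0$. In particular, if $h$ is positive definite, then $\phi$ is a harmonic map when $g$ is positive definite, and a wave map when $g$ is Lorentzian, of signature $(+,-,\dots,-)$. (A harmonic, respectively wave, map is a smooth map from a Riemannian, respectively Lorentzian, manifold to a Riemannian manifold with $\mathrm{tr}(\nabla d\phi)=0$.) -/

import Mathlib

open scoped Manifold ContDiff
open Bundle

noncomputable section

namespace EinsteinMap

/-! Local formulas on `ℝᵐ`. Here `G : ℝᵐ → Bil(ℝᵐ)` is a field of bilinear forms with components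
`g_ab(y) = G y e_a e_b`. -/

/-- The inverse metric `g^{-1}(y)`, as the index-raising map `(ℝᵐ)* → ℝᵐ`; its components are
`g^{ab}`, the entries of the inverse of the matrix `(g_ab)`. -/
def sharp {m : ℕ}
    (G : EuclideanSpace ℝ (Fin m) →
      EuclideanSpace ℝ (Fin m) →L[ℝ] EuclideanSpace ℝ (Fin m) →L[ℝ] ℝ)
    (y : EuclideanSpace ℝ (Fin m)) :
    (EuclideanSpace ℝ (Fin m) →L[ℝ] ℝ) →L[ℝ] EuclideanSpace ℝ (Fin m) :=
  (G y).inverse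

/-- The Christoffel symbols of `G` as a vector-valued bilinear expression:
`Γ(v, w)^c = Γ^c_ab v^a w^b` with
`Γ^c_ab = (1/2) g^{cd} (∂_a g_bd + ∂_b g_ad - ∂_d g_ab)`. -/
def christoffel {m : ℕ}
    (G : EuclideanSpace ℝ (Fin m) →
      EuclideanSpace ℝ (Fin m) →L[ℝ] EuclideanSpace ℝ (Fin m) →L[ℝ] ℝ)
    (y v w : EuclideanSpace ℝ (Fin m)) : EuclideanSpace ℝ (Fin m) :=
  sharp G y ((1 / 2 : ℝ) •
    (fderiv ℝ G y v w + fderiv ℝ G y w v - ((fderiv ℝ G y).flip v).flip w))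

/-- The Riemann curvature `R(u, v) w` of the Levi-Civita connection `D + Γ`, for constant `u, v, w`:
`R(u, v) w = D_u Γ(v, w) - D_v Γ(u, w) + Γ(u, Γ(v, w)) - Γ(v, Γ(u, w))`. -/
def curvature {m : ℕ}
    (G : EuclideanSpace ℝ (Fin m) →
      EuclideanSpace ℝ (Fin m) →L[ℝ] EuclideanSpace ℝ (Fin m) →L[ℝ] ℝ)
    (y u v w : EuclideanSpace ℝ (Fin m)) : EuclideanSpace ℝ (Fin m) :=
  fderiv ℝ (fun z ↦ christoffel G z v w) y u - fderiv ℝ (fun z ↦ christoffel G z u w) y v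
    + christoffel G y u (christoffel G y v w) - christoffel G y v (christoffel G y u w)

/-- The Ricci curvature `Ric(v, w)`, the trace of `u ↦ R(u, v) w`. -/
def ricciLocal {m : ℕ}
    (G : EuclideanSpace ℝ (Fin m) →
      EuclideanSpace ℝ (Fin m) →L[ℝ] EuclideanSpace ℝ (Fin m) →L[ℝ] ℝ)
    (y v w : EuclideanSpace ℝ (Fin m)) : ℝ :=
  ∑ a : Fin m, curvature G y (EuclideanSpace.single a 1) v w a

/-- The second fundamental form `∇dΦ` of a map `Φ : (ℝᵐ, G) → (ℝⁿ, H)`, in components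
`∇_a ∂_b Φ^k = ∂_a ∂_b Φ^k - Γ^c_ab ∂_c Φ^k + Γ^k_ij ∂_a Φ^i ∂_b Φ^j`,
with the Christoffel symbols of `G` and (at the point `Φ y`) of `H`. -/
def hessianLocal {m n : ℕ}
    (G : EuclideanSpace ℝ (Fin m) →
      EuclideanSpace ℝ (Fin m) →L[ℝ] EuclideanSpace ℝ (Fin m) →L[ℝ] ℝ)
    (H : EuclideanSpace ℝ (Fin n) →
      EuclideanSpace ℝ (Fin n) →L[ℝ] EuclideanSpace ℝ (Fin n) →L[ℝ] ℝ)
    (Φ : EuclideanSpace ℝ (Fin m) → EuclideanSpace ℝ (Fin n))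
    (y v w : EuclideanSpace ℝ (Fin m)) : EuclideanSpace ℝ (Fin n) :=
  fderiv ℝ (fderiv ℝ Φ) y v w - fderiv ℝ Φ y (christoffel G y v w)
    + christoffel H (Φ y) (fderiv ℝ Φ y v) (fderiv ℝ Φ y w)

/-- The trace `tr(∇dΦ)^k = g^{ab} ∇_a ∂_b Φ^k`. The vector `sharp G y (proj a)` has the
components `g^{ab}`, `b = 1, …, m`. -/
def tensionLocal {m n : ℕ}
    (G : EuclideanSpace ℝ (Fin m) →
      EuclideanSpace ℝ (Fin m) →L[ℝ] EuclideanSpace ℝ (Fin m) →L[ℝ] ℝ)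
    (H : EuclideanSpace ℝ (Fin n) →
      EuclideanSpace ℝ (Fin n) →L[ℝ] EuclideanSpace ℝ (Fin n) →L[ℝ] ℝ)
    (Φ : EuclideanSpace ℝ (Fin m) → EuclideanSpace ℝ (Fin n))
    (y : EuclideanSpace ℝ (Fin m)) : EuclideanSpace ℝ (Fin n) :=
  ∑ a : Fin m, hessianLocal G H Φ y (EuclideanSpace.single a 1)
    (sharp G y (EuclideanSpace.proj a))

/-- A smooth pseudo-Riemannian metric (of arbitrary signature) on an `m`-manifold `X`: a smooth
field of symmetric nondegenerate bilinear forms on the tangent spaces. -/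
structure PseudoRiemannianMetric (m : ℕ) (X : Type*) [TopologicalSpace X]
    [ChartedSpace (EuclideanSpace ℝ (Fin m)) X] [IsManifold (𝓡 m) ∞ X] where
  /-- The bilinear form on the tangent space at `x`. -/
  val (x : X) : TangentSpace (𝓡 m) x →L[ℝ] TangentSpace (𝓡 m) x →L[ℝ] ℝ
  symm (x : X) (v w : TangentSpace (𝓡 m) x) : val x v w = val x w v
  nondegenerate (x : X) (v : TangentSpace (𝓡 m) x) : (∀ w, val x v w = 0) → v = 0
  contMDiff : ContMDiff (𝓡 m)
    ((𝓡 m).prod 𝓘(ℝ, EuclideanSpace ℝ (Fin m) →L[ℝ] EuclideanSpace ℝ (Fin m) →L[ℝ] ℝ)) ∞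
    (fun x ↦ TotalSpace.mk' (EuclideanSpace ℝ (Fin m) →L[ℝ] EuclideanSpace ℝ (Fin m) →L[ℝ] ℝ)
      (E := fun x : X ↦ TangentSpace (𝓡 m) x →L[ℝ] TangentSpace (𝓡 m) x →L[ℝ] ℝ) x (val x))

namespace PseudoRiemannianMetric

variable {m : ℕ} {X : Type*} [TopologicalSpace X]
  [ChartedSpace (EuclideanSpace ℝ (Fin m)) X] [IsManifold (𝓡 m) ∞ X]

/-- `g` is properly Riemannian, that is, positive definite. -/
def IsRiemannian (g : PseudoRiemannianMetric m X) : Prop :=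
  ∀ (x : X) (v : TangentSpace (𝓡 m) x), v ≠ 0 → 0 < g.val x v v

/-- `g` is Lorentzian, of signature `(+ - ⋯ -)`: at each point there is a timelike vector on whose
orthogonal complement `g` is negative definite. -/
def IsLorentzian (g : PseudoRiemannianMetric m X) : Prop :=
  ∀ x : X, ∃ v : TangentSpace (𝓡 m) x, 0 < g.val x v v ∧
    ∀ w : TangentSpace (𝓡 m) x, g.val x v w = 0 → w ≠ 0 → g.val x w w < 0

/-- The metric `g` in the preferred chart `χ` around `p`: the pull-back of `g` under `χ⁻¹`, with
components `g_ab(y) = g(∂_a, ∂_b)` at the point `χ⁻¹(y)`. (Meaningful for `y` in the target.) -/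
def inChart (g : PseudoRiemannianMetric m X) (p : X) (y : EuclideanSpace ℝ (Fin m)) :
    EuclideanSpace ℝ (Fin m) →L[ℝ] EuclideanSpace ℝ (Fin m) →L[ℝ] ℝ :=
  let Q : EuclideanSpace ℝ (Fin m) →L[ℝ] EuclideanSpace ℝ (Fin m) →L[ℝ] ℝ :=
    g.val ((extChartAt (𝓡 m) p).symm y)
  let A : EuclideanSpace ℝ (Fin m) →L[ℝ] EuclideanSpace ℝ (Fin m) :=
    mfderiv (𝓡 m) (𝓡 m) (extChartAt (𝓡 m) p).symm y
  Q.bilinearComp A A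

/-- The Ricci tensor of `g`. It is computed in the preferred chart around `x`, which is the chart by
which the tangent space at `x` is identified with `ℝᵐ`. -/
def ricci (g : PseudoRiemannianMetric m X) (x : X) (v w : TangentSpace (𝓡 m) x) : ℝ :=
  ricciLocal (g.inChart x) (extChartAt (𝓡 m) x x) v w

end PseudoRiemannianMetric

variable {m n : ℕ} {X : Type*} [TopologicalSpace X]
  [ChartedSpace (EuclideanSpace ℝ (Fin m)) X] [IsManifold (𝓡 m) ∞ X]
  {Y : Type*} [TopologicalSpace Y]
  [ChartedSpace (EuclideanSpace ℝ (Fin n)) Y] [IsManifold (𝓡 n) ∞ Y]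

/-- The first fundamental form `φ^* h = h(dφ, dφ)`. -/
def firstFundamentalForm (h : PseudoRiemannianMetric n Y) (φ : X → Y) (x : X)
    (v w : TangentSpace (𝓡 m) x) : ℝ :=
  h.val (φ x) (mfderiv (𝓡 m) (𝓡 n) φ x v) (mfderiv (𝓡 m) (𝓡 n) φ x w)

/-- The Einstein equation `κ Ric = φ^* h`. -/
def EinsteinEquation (κ : ℝ) (g : PseudoRiemannianMetric m X) (h : PseudoRiemannianMetric n Y)
    (φ : X → Y) : Prop :=
  ∀ (x : X) (v w : TangentSpace (𝓡 m) x),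
    κ * g.ricci x v w = firstFundamentalForm h φ x v w

/-- The trace `tr(∇dφ)` with respect to `g` of the second fundamental form of `φ`, a vector field
along `φ`. It is computed in the preferred charts around `x` and `φ x`. -/
def tension (g : PseudoRiemannianMetric m X) (h : PseudoRiemannianMetric n Y)
    (φ : X → Y) (x : X) : TangentSpace (𝓡 n) (φ x) :=
  tensionLocal (g.inChart x) (h.inChart (φ x)) (writtenInExtChartAt (𝓡 m) (𝓡 n) x φ)
    (extChartAt (𝓡 m) x x)

/-- The equation `h(tr(∇dφ), dφ) = 0`, an equation between one-forms on `X`. -/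
def TensionOrthogonal (g : PseudoRiemannianMetric m X) (h : PseudoRiemannianMetric n Y)
    (φ : X → Y) : Prop :=
  ∀ (x : X) (v : TangentSpace (𝓡 m) x),
    h.val (φ x) (tension g h φ x) (mfderiv (𝓡 m) (𝓡 n) φ x v) = 0

/-- A submersion: the differential has rank `n = dim Y` at every point. -/
def IsSubmersive (m n : ℕ) {X : Type*} [TopologicalSpace X]
    [ChartedSpace (EuclideanSpace ℝ (Fin m)) X]
    {Y : Type*} [TopologicalSpace Y] [ChartedSpace (EuclideanSpace ℝ (Fin n)) Y]
    (φ : X → Y) : Prop :=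
  ∀ x : X, Function.Surjective (mfderiv (𝓡 m) (𝓡 n) φ x)

/-- A harmonic map: a smooth map between properly Riemannian manifolds with `tr(∇dφ) = 0`. -/
structure IsHarmonicMap (g : PseudoRiemannianMetric m X) (h : PseudoRiemannianMetric n Y)
    (φ : X → Y) : Prop where
  source : g.IsRiemannian
  target : h.IsRiemannian
  smooth : ContMDiff (𝓡 m) (𝓡 n) ∞ φ
  tension_eq_zero : ∀ x, tension g h φ x = 0

/-- A wave map: a smooth map from a Lorentzian to a properly Riemannian manifold with
`tr(∇dφ) = 0`. -/
structure IsWaveMap (g : PseudoRiemannianMetric m X) (h : PseudoRiemannianMetric n Y)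
    (φ : X → Y) : Prop where
  source : g.IsLorentzian
  target : h.IsRiemannian
  smooth : ContMDiff (𝓡 m) (𝓡 n) ∞ φ
  tension_eq_zero : ∀ x, tension g h φ x = 0

end EinsteinMap

end

/-!
The first claim results from comparing the divergences of the two sides of the Einstein equation.
Put `T = φ^* h = h(dφ, dφ)`. Since `∇dφ` is symmetric,
`2 div T - d (tr T) = 2 h(tr ∇dφ, dφ)`, because the remaining terms `h(dφ, ∇dφ)` of the two summands
cancel (`covDerivForm_pullback`, `tensionLocal_orthogonal`). On the other hand
`2 div Ric - d (tr Ric) = 0`, the contracted Bianchi identity (`contracted_bianchi`), so the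
left hand side vanishes if `T = κ Ric`. The second claim is the nondegeneracy of `h`, and the third
combines the two.

The computation takes place in a chart. The expressions `div T` and `d (tr T)` are here the two
contractions of the covariant derivative `∇T`, so the inverse metric is never differentiated, and
the contracted Bianchi identity is a formal consequence of the second Bianchi identity
(`covDerivCurvature_cyclic`) and of the skew-adjointness of `∇R` (`metric_covDerivCurvature_skew`).

Since `g.ricci` is computed at each point in the preferred chart of that point, the Einstein
equation must first be brought to a single chart, around a given point. This requires the
tensoriality of the Ricci curvature: local isometries are affine maps of the Levi-Civita connections
(`leviCivita_of_isometry`), hence intertwine curvatures (`curvatureForm_of_affine`) and preserve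
their traces (`ricciLocal_of_isometry`, `ricciLocal_inChart`).
-/

open scoped Topology

noncomputable section

namespace EinsteinMap

-- Iterated spaces of continuous linear maps need a deeper instance search.
set_option maxSynthPendingDepth 3

/-! ### Connections on a normed space and their curvature -/

section Connection

variable {E : Type*} [NormedAddCommGroup E] [NormedSpace ℝ E]

/-- The curvature `R(u, v) = ∂_u Γ_v - ∂_v Γ_u + [Γ_u, Γ_v]` of the connection `D + Γ` on the
tangent bundle of a normed space, as a field of endomorphisms. -/
def curvatureForm (Γ : E → E →L[ℝ] E →L[ℝ] E) (y u v : E) : E →L[ℝ] E :=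
  fderiv ℝ Γ y u v - fderiv ℝ Γ y v u + Γ y u * Γ y v - Γ y v * Γ y u

/-- The covariant derivative `(∇_t R)(u, v)` of the curvature of the connection `D + Γ`. -/
def covDerivCurvature (Γ : E → E →L[ℝ] E →L[ℝ] E) (y t u v : E) : E →L[ℝ] E :=
  fderiv ℝ (fun z ↦ curvatureForm Γ z u v) y t
    + Γ y t * curvatureForm Γ y u v - curvatureForm Γ y u v * Γ y t
    - curvatureForm Γ y (Γ y t u) v - curvatureForm Γ y u (Γ y t v)

variable {Γ : E → E →L[ℝ] E →L[ℝ] E} {y : E}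

lemma curvatureForm_swap (y u v : E) : curvatureForm Γ y v u = -curvatureForm Γ y u v := by
  unfold curvatureForm; abel

lemma covDerivCurvature_swap (y t u v : E) :
    covDerivCurvature Γ y t v u = -covDerivCurvature Γ y t u v := by
  have h : (fun z ↦ curvatureForm Γ z v u) = fun z ↦ -curvatureForm Γ z u v :=
    funext fun z ↦ curvatureForm_swap z u v
  simp only [covDerivCurvature, h, fderiv_fun_neg, curvatureForm_swap y u v,
    curvatureForm_swap y (Γ y t u) v, curvatureForm_swap y u (Γ y t v), neg_apply]
  noncomm_ring

lemma hasFDerivAt_apply_of_contDiffAt (hΓ : ContDiffAt ℝ 2 Γ y) (u : E) :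
    HasFDerivAt (fun z ↦ Γ z u) ((fderiv ℝ Γ y).flip u) y :=
  ((hΓ.differentiableAt (by simp)).hasFDerivAt.clm_apply (hasFDerivAt_const u y)).congr_fderiv
    (by ext; simp)

lemma differentiableAt_fderiv_of_contDiffAt {F : Type*} [NormedAddCommGroup F] [NormedSpace ℝ F]
    {f : E → F} (hf : ContDiffAt ℝ 2 f y) : DifferentiableAt ℝ (fderiv ℝ f) y :=
  (hf.fderiv_right (m := 1) (by norm_num)).differentiableAt (by simp)

lemma hasFDerivAt_fderiv_apply₂ {F : Type*} [NormedAddCommGroup F] [NormedSpace ℝ F]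
    {f : E → E →L[ℝ] F} (hf : ContDiffAt ℝ 2 f y) (u v : E) :
    HasFDerivAt (fun z ↦ fderiv ℝ f z u v) (((fderiv ℝ (fderiv ℝ f) y).flip u).flip v) y :=
  (((differentiableAt_fderiv_of_contDiffAt hf).hasFDerivAt.clm_apply
    (hasFDerivAt_const u y)).clm_apply (hasFDerivAt_const v y)).congr_fderiv (by ext; simp)

lemma differentiableAt_curvatureForm (hΓ : ContDiffAt ℝ 2 Γ y) (u v : E) :
    DifferentiableAt ℝ (fun z ↦ curvatureForm Γ z u v) y := by
  unfold curvatureForm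
  exact ((((hasFDerivAt_fderiv_apply₂ hΓ u v).sub (hasFDerivAt_fderiv_apply₂ hΓ v u)).add
    ((hasFDerivAt_apply_of_contDiffAt hΓ u).mul' (hasFDerivAt_apply_of_contDiffAt hΓ v))).sub
    ((hasFDerivAt_apply_of_contDiffAt hΓ v).mul'
      (hasFDerivAt_apply_of_contDiffAt hΓ u))).differentiableAt

lemma fderiv_curvatureForm (hΓ : ContDiffAt ℝ 2 Γ y) (t u v : E) :
    fderiv ℝ (fun z ↦ curvatureForm Γ z u v) y t =
      fderiv ℝ (fderiv ℝ Γ) y t u v - fderiv ℝ (fderiv ℝ Γ) y t v u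
        + (Γ y u * fderiv ℝ Γ y t v + fderiv ℝ Γ y t u * Γ y v)
        - (Γ y v * fderiv ℝ Γ y t u + fderiv ℝ Γ y t v * Γ y u) := by
  have h := (((hasFDerivAt_fderiv_apply₂ hΓ u v).sub (hasFDerivAt_fderiv_apply₂ hΓ v u)).add
    ((hasFDerivAt_apply_of_contDiffAt hΓ u).mul' (hasFDerivAt_apply_of_contDiffAt hΓ v))).sub
    ((hasFDerivAt_apply_of_contDiffAt hΓ v).mul' (hasFDerivAt_apply_of_contDiffAt hΓ u))
  exact DFunLike.congr_fun h.fderiv t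

lemma second_fderiv_comm {F : Type*} [NormedAddCommGroup F] [NormedSpace ℝ F]
    {f : E → F} (hf : ContDiffAt ℝ 2 f y) (u v : E) :
    fderiv ℝ (fderiv ℝ f) y u v = fderiv ℝ (fderiv ℝ f) y v u :=
  hf.isSymmSndFDerivAt (by simp) u v

/-- The second Bianchi identity, for a torsion-free connection. -/
theorem covDerivCurvature_cyclic (hΓ : ContDiffAt ℝ 2 Γ y)
    (hsymm : ∀ u v, Γ y u v = Γ y v u) (t u v : E) :
    covDerivCurvature Γ y t u v + covDerivCurvature Γ y u v t + covDerivCurvature Γ y v t u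
      = 0 := by
  simp only [covDerivCurvature, fderiv_curvatureForm hΓ, second_fderiv_comm hΓ v,
    second_fderiv_comm hΓ u t, hsymm v, hsymm u t, curvatureForm_swap y t (Γ y u v),
    curvatureForm_swap y u (Γ y t v), curvatureForm_swap y v (Γ y t u)]
  simp only [curvatureForm]
  noncomm_ring

/-- The differentiated metric compatibility `∂_s ∂_u G = G(∂_s (Γ_u ·), ·) + G(·, ∂_s (Γ_u ·))`. -/
lemma second_fderiv_metric {G : E → E →L[ℝ] E →L[ℝ] ℝ} (hG : ContDiffAt ℝ 2 G y)
    (hΓ : ContDiffAt ℝ 2 Γ y)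
    (hc : ∀ᶠ z in 𝓝 y, ∀ u v w, fderiv ℝ G z u v w = G z (Γ z u v) w + G z v (Γ z u w))
    (s u v w : E) :
    fderiv ℝ (fderiv ℝ G) y s u v w =
      fderiv ℝ G y s (Γ y u v) w + G y (fderiv ℝ Γ y s u v) w
        + (fderiv ℝ G y s v (Γ y u w) + G y v (fderiv ℝ Γ y s u w)) := by
  have hG' := (hG.differentiableAt (by simp)).hasFDerivAt
  have hΓu := hasFDerivAt_apply_of_contDiffAt hΓ u
  have h1 := (hasFDerivAt_fderiv_apply₂ hG u v).clm_apply (hasFDerivAt_const w y)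
  have h2 := ((hG'.clm_apply (hΓu.clm_apply (hasFDerivAt_const v y))).clm_apply
      (hasFDerivAt_const w y)).add
    ((hG'.clm_apply (hasFDerivAt_const v y)).clm_apply
      (hΓu.clm_apply (hasFDerivAt_const w y)))
  have h3 := h1.congr_of_eventuallyEq (f₁ := fun z ↦ G z (Γ z u v) w + G z v (Γ z u w))
    (hc.mono fun z hz ↦ (hz u v w).symm)
  have h4 := DFunLike.congr_fun (h3.unique h2) s
  simp at h4
  linarith

/-- The curvature of a metric connection is skew-adjoint. -/
theorem metric_curvatureForm_skew {G : E → E →L[ℝ] E →L[ℝ] ℝ} (hG : ContDiffAt ℝ 2 G y)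
    (hΓ : ContDiffAt ℝ 2 Γ y)
    (hc : ∀ᶠ z in 𝓝 y, ∀ u v w, fderiv ℝ G z u v w = G z (Γ z u v) w + G z v (Γ z u w))
    (u v a b : E) :
    G y (curvatureForm Γ y u v a) b + G y a (curvatureForm Γ y u v b) = 0 := by
  have h1 := second_fderiv_metric hG hΓ hc u v a b
  have h2 := second_fderiv_metric hG hΓ hc v u a b
  rw [second_fderiv_comm hG v u] at h2
  simp only [hc.self_of_nhds] at h1 h2
  simp [curvatureForm, sub_apply, add_apply]
  linarith

/-- The covariant derivative of the curvature of a metric connection is skew-adjoint. -/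
theorem metric_covDerivCurvature_skew {G : E → E →L[ℝ] E →L[ℝ] ℝ}
    (hG : ∀ᶠ z in 𝓝 y, ContDiffAt ℝ 2 G z) (hΓ : ∀ᶠ z in 𝓝 y, ContDiffAt ℝ 2 Γ z)
    (hc : ∀ᶠ z in 𝓝 y, ∀ u v w, fderiv ℝ G z u v w = G z (Γ z u v) w + G z v (Γ z u w))
    (t u v a b : E) :
    G y (covDerivCurvature Γ y t u v a) b + G y a (covDerivCurvature Γ y t u v b) = 0 := by
  have hskew : ∀ᶠ z in 𝓝 y, ∀ u v a b,
      G z (curvatureForm Γ z u v a) b + G z a (curvatureForm Γ z u v b) = 0 := by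
    filter_upwards [hG, hΓ, hc.eventually_nhds] with z h1 h2 h3 u v a b
    exact metric_curvatureForm_skew h1 h2 h3 u v a b
  have hG' := (hG.self_of_nhds.differentiableAt (by simp)).hasFDerivAt
  have hR := (differentiableAt_curvatureForm hΓ.self_of_nhds u v).hasFDerivAt
  have h2 := ((hG'.clm_apply (hR.clm_apply (hasFDerivAt_const a y))).clm_apply
      (hasFDerivAt_const b y)).add
    ((hG'.clm_apply (hasFDerivAt_const a y)).clm_apply
      (hR.clm_apply (hasFDerivAt_const b y)))
  have h3 := (hasFDerivAt_const (𝕜 := ℝ) (0 : ℝ) y).congr_of_eventuallyEq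
    (f₁ := fun z ↦ G z (curvatureForm Γ z u v a) b + G z a (curvatureForm Γ z u v b))
    (hskew.mono fun z hz ↦ hz u v a b)
  have h4 := DFunLike.congr_fun (h3.unique h2) t
  have hs := hskew.self_of_nhds
  simp [hc.self_of_nhds] at h4
  simp [covDerivCurvature]
  linarith [hs u v (Γ y t a) b, hs u v a (Γ y t b), hs (Γ y t u) v a b, hs u (Γ y t v) a b]

end Connection

/-! ### Affine maps between connections -/

section Gauge

variable {E E' : Type*} [NormedAddCommGroup E] [NormedSpace ℝ E]
  [NormedAddCommGroup E'] [NormedSpace ℝ E']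

/-- If `ψ` is an affine map from the connection `D + Γ` to the connection `D + Γ'`, that is,
`dψ(Γ(u, v)) = Γ'(dψ u, dψ v) + D²ψ(u, v)`, then `dψ` intertwines their curvatures. -/
theorem curvatureForm_of_affine {Γ : E → E →L[ℝ] E →L[ℝ] E} {Γ' : E' → E' →L[ℝ] E' →L[ℝ] E'}
    {ψ : E → E'} {y : E} (hΓ : ContDiffAt ℝ 2 Γ y) (hΓ' : ContDiffAt ℝ 2 Γ' (ψ y))
    (hψ : ContDiffAt ℝ 3 ψ y)
    (hc : ∀ᶠ z in 𝓝 y, ∀ u v, fderiv ℝ ψ z (Γ z u v) =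
      Γ' (ψ z) (fderiv ℝ ψ z u) (fderiv ℝ ψ z v) + fderiv ℝ (fderiv ℝ ψ) z u v)
    (u v w : E) :
    fderiv ℝ ψ y (curvatureForm Γ y u v w) =
      curvatureForm Γ' (ψ y) (fderiv ℝ ψ y u) (fderiv ℝ ψ y v) (fderiv ℝ ψ y w) := by
  have hψ' : HasFDerivAt ψ (fderiv ℝ ψ y) y := (hψ.differentiableAt (by simp)).hasFDerivAt
  have hA : ContDiffAt ℝ 2 (fderiv ℝ ψ) y := hψ.fderiv_right (by norm_num)
  have hA' := (hA.differentiableAt (by simp)).hasFDerivAt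
  have hΓ'' : HasFDerivAt (fun z ↦ Γ' (ψ z)) ((fderiv ℝ Γ' (ψ y)).comp (fderiv ℝ ψ y)) y :=
    (hΓ'.differentiableAt (by simp)).hasFDerivAt.comp y hψ'
  -- The derivative in the direction `s` of the condition that `ψ` is affine. Up to the terms
  -- symmetric in `s` and `u`, its antisymmetrization is the claim.
  have key : ∀ s u : E, fderiv ℝ (fderiv ℝ ψ) y s (Γ y u w) + fderiv ℝ ψ y (fderiv ℝ Γ y s u w) =
      fderiv ℝ Γ' (ψ y) (fderiv ℝ ψ y s) (fderiv ℝ ψ y u) (fderiv ℝ ψ y w)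
      + Γ' (ψ y) (fderiv ℝ (fderiv ℝ ψ) y s u) (fderiv ℝ ψ y w)
      + Γ' (ψ y) (fderiv ℝ ψ y u) (fderiv ℝ (fderiv ℝ ψ) y s w)
      + fderiv ℝ (fderiv ℝ (fderiv ℝ ψ)) y s u w := by
    intro s u
    have h1 := hA'.clm_apply
      ((hasFDerivAt_apply_of_contDiffAt hΓ u).clm_apply (hasFDerivAt_const w y))
    have h2 := ((hΓ''.clm_apply (hA'.clm_apply (hasFDerivAt_const u y))).clm_apply
      (hA'.clm_apply (hasFDerivAt_const w y))).add (hasFDerivAt_fderiv_apply₂ hA u w)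
    have h3 := h1.congr_of_eventuallyEq (f₁ := fun z ↦
      Γ' (ψ z) (fderiv ℝ ψ z u) (fderiv ℝ ψ z w) + fderiv ℝ (fderiv ℝ ψ) z u w)
      (hc.mono fun z hz ↦ (hz u w).symm)
    have h4 := DFunLike.congr_fun (h3.unique h2) s
    simp at h4
    rw [add_comm, ← sub_eq_zero] at h4
    rw [← sub_eq_zero, ← h4]
    abel
  have k1 := key u v
  have k2 := key v u
  have hc0 := hc.self_of_nhds
  have e : ∀ s, fderiv ℝ (fderiv ℝ ψ) y s w =
      fderiv ℝ ψ y (Γ y s w) - Γ' (ψ y) (fderiv ℝ ψ y s) (fderiv ℝ ψ y w) :=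
    fun s ↦ by rw [hc0]; abel
  rw [e u, map_sub] at k1
  rw [e v, map_sub] at k2
  have hs : fderiv ℝ (fderiv ℝ ψ) y u v = fderiv ℝ (fderiv ℝ ψ) y v u :=
    second_fderiv_comm (hψ.of_le (by norm_num)) u v
  have hs2 : fderiv ℝ (fderiv ℝ (fderiv ℝ ψ)) y u v = fderiv ℝ (fderiv ℝ (fderiv ℝ ψ)) y v u :=
    second_fderiv_comm hA u v
  rw [hs, hs2] at k1
  have k3 := hc0 u (Γ y v w)
  have k4 := hc0 v (Γ y u w)
  simp [curvatureForm]
  rw [k3, k4]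
  rw [← eq_sub_iff_add_eq'] at k1 k2
  rw [k1, k2]
  abel

end Gauge

/-! ### The Levi-Civita connection of a metric on `ℝᵐ` -/

/-- The coordinate space `ℝᵐ`. -/
abbrev Coord (m : ℕ) : Type := EuclideanSpace ℝ (Fin m)

/-- A field of bilinear forms on `ℝᵐ`. -/
abbrev FormField (m : ℕ) : Type := Coord m → Coord m →L[ℝ] Coord m →L[ℝ] ℝ

/-- `G` is a smooth pseudo-Riemannian metric on the open set `U`. -/
structure IsMetricOn {m : ℕ} (G : FormField m) (U : Set (Coord m)) : Prop where
  isOpen : IsOpen U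
  contDiffOn : ContDiffOn ℝ ∞ G U
  symm : ∀ y ∈ U, ∀ v w, G y v w = G y w v
  nondegenerate : ∀ y ∈ U, ∀ v, (∀ w, G y v w = 0) → v = 0

/-- The Christoffel symbols of the first kind, `½ (∂_v g(w, t) + ∂_w g(v, t) - ∂_t g(v, w))`, as a
trilinear form. -/
def christoffelFirst {m : ℕ} (G : FormField m) (y : Coord m) :
    Coord m →L[ℝ] Coord m →L[ℝ] Coord m →L[ℝ] ℝ :=
  (1 / 2 : ℝ) • (fderiv ℝ G y + (fderiv ℝ G y).flip -
    ((ContinuousLinearMap.flipₗᵢ ℝ (Coord m) (Coord m) ℝ).toContinuousLinearEquiv :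
      (Coord m →L[ℝ] Coord m →L[ℝ] ℝ) →L[ℝ] (Coord m →L[ℝ] Coord m →L[ℝ] ℝ)).comp
      (fderiv ℝ G y).flip)

/-- The Christoffel symbols `christoffel G`, as a field of bilinear maps. -/
def leviCivita {m : ℕ} (G : FormField m) (y : Coord m) : Coord m →L[ℝ] Coord m →L[ℝ] Coord m :=
  (ContinuousLinearMap.compL ℝ (Coord m) (Coord m →L[ℝ] ℝ) (Coord m) (sharp G y)).comp
    (christoffelFirst G y)

section LeviCivita

variable {m : ℕ} {G : FormField m} {U : Set (Coord m)} {y : Coord m}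

lemma leviCivita_apply (y v w : Coord m) : leviCivita G y v w = christoffel G y v w := by
  change sharp G y (christoffelFirst G y v w) = _
  rfl

lemma christoffelFirst_apply (y u v w : Coord m) : christoffelFirst G y u v w =
    1 / 2 * (fderiv ℝ G y u v w + fderiv ℝ G y v u w - fderiv ℝ G y w u v) := by
  simp [christoffelFirst]

lemma finrank_coord_dual : Module.finrank ℝ (Coord m) = Module.finrank ℝ (Coord m →L[ℝ] ℝ) := by
  rw [← (LinearMap.toContinuousLinearMap (𝕜 := ℝ) (E := Coord m) (F' := ℝ)).finrank_eq]
  exact Subspace.dual_finrank_eq.symm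

namespace IsMetricOn

/-- On `U`, the map `sharp G y` is the genuine inverse of `G y`. -/
lemma isInvertible (hG : IsMetricOn G U) (hy : y ∈ U) : (G y).IsInvertible := by
  have hinj : Function.Injective (G y : Coord m →ₗ[ℝ] (Coord m →L[ℝ] ℝ)) := by
    rw [← LinearMap.ker_eq_bot, LinearMap.ker_eq_bot']
    intro v hv
    exact hG.nondegenerate y hy v fun w ↦ DFunLike.congr_fun hv w
  let e := (LinearEquiv.ofInjectiveOfFinrankEq _ hinj finrank_coord_dual).toContinuousLinearEquiv
  exact ⟨e, by ext; rfl⟩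

lemma apply_sharp (hG : IsMetricOn G U) (hy : y ∈ U) (α : Coord m →L[ℝ] ℝ) :
    G y (sharp G y α) = α := by
  obtain ⟨e, he⟩ := hG.isInvertible hy
  rw [sharp, ← he, ContinuousLinearMap.inverse_equiv]
  exact e.apply_symm_apply α

lemma contDiffAt (hG : IsMetricOn G U) (hy : y ∈ U) : ContDiffAt ℝ ∞ G y :=
  hG.contDiffOn.contDiffAt (hG.isOpen.mem_nhds hy)

lemma contDiffAt_sharp (hG : IsMetricOn G U) (hy : y ∈ U) : ContDiffAt ℝ ∞ (sharp G) y := by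
  obtain ⟨e, he⟩ := hG.isInvertible hy
  have h : ContDiffAt ℝ ∞ ContinuousLinearMap.inverse (G y) := he ▸ contDiffAt_map_inverse e
  exact h.comp y (hG.contDiffAt hy)

lemma contDiffAt_leviCivita (hG : IsMetricOn G U) (hy : y ∈ U) :
    ContDiffAt ℝ ∞ (leviCivita G) y := by
  have hD : ContDiffAt ℝ ∞ (fderiv ℝ G) y := (hG.contDiffAt hy).fderiv_right (by simp)
  have hflip : ContDiffAt ℝ ∞ (fun z ↦ (fderiv ℝ G z).flip) y :=
    (ContinuousLinearMap.flipₗᵢ ℝ (Coord m) (Coord m)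
      (Coord m →L[ℝ] ℝ)).contDiff.contDiffAt.comp y hD
  have hF : ContDiffAt ℝ ∞ (christoffelFirst G) y :=
    ((hD.add hflip).sub (contDiffAt_const.clm_comp hflip)).const_smul (1 / 2 : ℝ)
  exact ((ContinuousLinearMap.compL ℝ (Coord m) (Coord m →L[ℝ] ℝ)
    (Coord m)).contDiff.contDiffAt.comp y (hG.contDiffAt_sharp hy)).clm_comp hF

lemma eventually_contDiffAt_two (hG : IsMetricOn G U) (hy : y ∈ U) :
    ∀ᶠ z in 𝓝 y, ContDiffAt ℝ 2 G z :=
  (hG.isOpen.eventually_mem hy).mono fun _ hz ↦ (hG.contDiffAt hz).of_le (ENat.LEInfty.out)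

lemma eventually_contDiffAt_leviCivita (hG : IsMetricOn G U) (hy : y ∈ U) :
    ∀ᶠ z in 𝓝 y, ContDiffAt ℝ 2 (leviCivita G) z :=
  (hG.isOpen.eventually_mem hy).mono fun _ hz ↦
    (hG.contDiffAt_leviCivita hz).of_le (ENat.LEInfty.out)

lemma fderiv_symm (hG : IsMetricOn G U) (hy : y ∈ U) (u v w : Coord m) :
    fderiv ℝ G y u v w = fderiv ℝ G y u w v := by
  have hG' := ((hG.contDiffAt hy).differentiableAt (by simp)).hasFDerivAt
  have h1 := (hG'.clm_apply (hasFDerivAt_const v y)).clm_apply (hasFDerivAt_const w y)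
  have h2 := (hG'.clm_apply (hasFDerivAt_const w y)).clm_apply (hasFDerivAt_const v y)
  have h3 := h1.congr_of_eventuallyEq (f₁ := fun z ↦ G z w v)
    ((hG.isOpen.eventually_mem hy).mono fun z hz ↦ hG.symm z hz w v)
  simpa using DFunLike.congr_fun (h3.unique h2) u

/-- The Koszul formula. -/
lemma apply_leviCivita (hG : IsMetricOn G U) (hy : y ∈ U) (u v w : Coord m) :
    G y (leviCivita G y u v) w =
      1 / 2 * (fderiv ℝ G y u v w + fderiv ℝ G y v u w - fderiv ℝ G y w u v) := by
  rw [← christoffelFirst_apply]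
  exact DFunLike.congr_fun (hG.apply_sharp hy _) w

lemma leviCivita_symm (hG : IsMetricOn G U) (hy : y ∈ U) (u v : Coord m) :
    leviCivita G y u v = leviCivita G y v u := by
  rw [← sub_eq_zero]
  refine hG.nondegenerate y hy _ fun w ↦ ?_
  rw [map_sub, sub_apply, hG.apply_leviCivita hy, hG.apply_leviCivita hy, hG.fderiv_symm hy w u v]
  ring

lemma leviCivita_compatible (hG : IsMetricOn G U) (hy : y ∈ U) (u v w : Coord m) :
    fderiv ℝ G y u v w = G y (leviCivita G y u v) w + G y v (leviCivita G y u w) := by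
  rw [hG.symm y hy v, hG.apply_leviCivita hy, hG.apply_leviCivita hy, hG.fderiv_symm hy u w v]
  ring

lemma eventually_compatible (hG : IsMetricOn G U) (hy : y ∈ U) :
    ∀ᶠ z in 𝓝 y, ∀ u v w, fderiv ℝ G z u v w =
      G z (leviCivita G z u v) w + G z v (leviCivita G z u w) :=
  (hG.isOpen.eventually_mem hy).mono fun _ hz ↦ hG.leviCivita_compatible hz

lemma curvature_eq (hG : IsMetricOn G U) (hy : y ∈ U) (u v w : Coord m) :
    curvature G y u v w = curvatureForm (leviCivita G) y u v w := by
  have h : ∀ a b c, fderiv ℝ (fun z ↦ christoffel G z a b) y c =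
      fderiv ℝ (leviCivita G) y c a b := by
    intro a b c
    simp only [← leviCivita_apply]
    have h1 := (((hG.contDiffAt_leviCivita hy).differentiableAt (by simp)).hasFDerivAt.clm_apply
      (hasFDerivAt_const a y)).clm_apply (hasFDerivAt_const b y)
    rw [h1.fderiv]
    simp
  simp only [curvature, h]
  simp only [← leviCivita_apply]
  simp [curvatureForm]

lemma ricciLocal_eq (hG : IsMetricOn G U) (hy : y ∈ U) (v w : Coord m) :
    ricciLocal G y v w =
      ∑ a, curvatureForm (leviCivita G) y (EuclideanSpace.single a 1) v w a := by
  simp only [ricciLocal, hG.curvature_eq hy]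

end IsMetricOn

lemma sum_single_eq_trace (L : Coord m →ₗ[ℝ] Coord m) :
    ∑ a, L (EuclideanSpace.single a 1) a = LinearMap.trace ℝ (Coord m) L := by
  rw [LinearMap.trace_eq_sum_inner L (EuclideanSpace.basisFun (Fin m) ℝ)]
  simp [EuclideanSpace.inner_single_left]

/-- The endomorphism `u ↦ R(u, v) w`, whose trace is the Ricci curvature. -/
def jacobiMap {E : Type*} [NormedAddCommGroup E] [NormedSpace ℝ E]
    (Γ : E → E →L[ℝ] E →L[ℝ] E) (y v w : E) : E →ₗ[ℝ] E where
  toFun u := curvatureForm Γ y u v w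
  map_add' a b := by simp [curvatureForm]; abel
  map_smul' c a := by simp [curvatureForm, smul_sub, smul_add]

end LeviCivita

/-! ### Local isometries -/

section Isometry

variable {m : ℕ} {G G' : FormField m} {U U' : Set (Coord m)} {ψ : Coord m → Coord m} {y : Coord m}

/-- The derivative of the pulled-back form `T(v, w) = H(dΦ v, dΦ w)`. -/
lemma hasFDerivAt_pullback {n : ℕ} {H : FormField n} {Φ : Coord m → Coord n}
    (hΦ : ContDiffAt ℝ 2 Φ y) (hH : DifferentiableAt ℝ H (Φ y)) (v w : Coord m) :
    ∃ L : Coord m →L[ℝ] ℝ,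
      HasFDerivAt (fun z ↦ H (Φ z) (fderiv ℝ Φ z v) (fderiv ℝ Φ z w)) L y ∧
      ∀ u, L u = fderiv ℝ H (Φ y) (fderiv ℝ Φ y u) (fderiv ℝ Φ y v) (fderiv ℝ Φ y w)
        + H (Φ y) (fderiv ℝ (fderiv ℝ Φ) y u v) (fderiv ℝ Φ y w)
        + H (Φ y) (fderiv ℝ Φ y v) (fderiv ℝ (fderiv ℝ Φ) y u w) := by
  have hA := (differentiableAt_fderiv_of_contDiffAt hΦ).hasFDerivAt
  have hH' : HasFDerivAt (fun z ↦ H (Φ z)) ((fderiv ℝ H (Φ y)).comp (fderiv ℝ Φ y)) y :=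
    hH.hasFDerivAt.comp y (hΦ.differentiableAt (by simp)).hasFDerivAt
  refine ⟨_, (hH'.clm_apply (hA.clm_apply (hasFDerivAt_const v y))).clm_apply
    (hA.clm_apply (hasFDerivAt_const w y)), fun u ↦ ?_⟩
  simp
  ring

/-- A map which pulls a metric back to a nondegenerate form is an immersion. -/
lemma fderiv_injective_of_isometry (hG : IsMetricOn G U) (hy : y ∈ U)
    (h : ∀ v w, G y v w = G' (ψ y) (fderiv ℝ ψ y v) (fderiv ℝ ψ y w)) :
    Function.Injective (fderiv ℝ ψ y : Coord m →ₗ[ℝ] Coord m) := by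
  rw [← LinearMap.ker_eq_bot, LinearMap.ker_eq_bot']
  intro v hv
  refine hG.nondegenerate y hy v fun w ↦ ?_
  have : fderiv ℝ ψ y v = 0 := hv
  rw [h, this]
  simp

/-- The transformation law of the Christoffel symbols. -/
lemma leviCivita_of_isometry (hG : IsMetricOn G U) (hy : y ∈ U) (hG' : IsMetricOn G' U')
    (hy' : ψ y ∈ U') (hψ : ContDiffAt ℝ 2 ψ y)
    (h : ∀ᶠ z in 𝓝 y, ∀ v w, G z v w = G' (ψ z) (fderiv ℝ ψ z v) (fderiv ℝ ψ z w))
    (u v : Coord m) :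
    fderiv ℝ ψ y (leviCivita G y u v) =
      leviCivita G' (ψ y) (fderiv ℝ ψ y u) (fderiv ℝ ψ y v)
        + fderiv ℝ (fderiv ℝ ψ) y u v := by
  have hsurj := LinearMap.injective_iff_surjective.1
    (fderiv_injective_of_isometry hG hy h.self_of_nhds)
  have hD : ∀ a b c, fderiv ℝ G y a b c =
      fderiv ℝ G' (ψ y) (fderiv ℝ ψ y a) (fderiv ℝ ψ y b) (fderiv ℝ ψ y c)
        + G' (ψ y) (fderiv ℝ (fderiv ℝ ψ) y a b) (fderiv ℝ ψ y c)
        + G' (ψ y) (fderiv ℝ ψ y b) (fderiv ℝ (fderiv ℝ ψ) y a c) := by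
    intro a b c
    obtain ⟨L, hL, hL'⟩ := hasFDerivAt_pullback (H := G') hψ
      ((hG'.contDiffAt hy').differentiableAt (by simp)) b c
    have h1 := (((hG.contDiffAt hy).differentiableAt (by simp)).hasFDerivAt.clm_apply
      (hasFDerivAt_const b y)).clm_apply (hasFDerivAt_const c y)
    have h2 := h1.congr_of_eventuallyEq
      (f₁ := fun z ↦ G' (ψ z) (fderiv ℝ ψ z b) (fderiv ℝ ψ z c))
      (h.mono fun z hz ↦ (hz b c).symm)
    rw [← hL', ← h2.unique hL]
    simp
  rw [← sub_eq_zero]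
  refine hG'.nondegenerate _ hy' _ fun w' ↦ ?_
  obtain ⟨w, rfl⟩ := hsurj w'
  simp only [ContinuousLinearMap.coe_coe, map_sub, sub_apply, map_add, add_apply]
  rw [← h.self_of_nhds, hG.apply_leviCivita hy, hG'.apply_leviCivita hy', hD, hD, hD,
    second_fderiv_comm hψ w u, second_fderiv_comm hψ w v, second_fderiv_comm hψ v u,
    hG'.symm _ hy' (fderiv ℝ ψ y v), hG'.symm _ hy' (fderiv ℝ ψ y u)]
  ring

/-- Local isometries preserve the Ricci tensor. -/
theorem ricciLocal_of_isometry (hG : IsMetricOn G U) (hy : y ∈ U) (hG' : IsMetricOn G' U')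
    (hy' : ψ y ∈ U') (hψ : ContDiffAt ℝ 3 ψ y)
    (h : ∀ᶠ z in 𝓝 y, ∀ v w, G z v w = G' (ψ z) (fderiv ℝ ψ z v) (fderiv ℝ ψ z w))
    (v w : Coord m) :
    ricciLocal G y v w = ricciLocal G' (ψ y) (fderiv ℝ ψ y v) (fderiv ℝ ψ y w) := by
  have hc : ∀ᶠ z in 𝓝 y, ∀ u v, fderiv ℝ ψ z (leviCivita G z u v) =
      leviCivita G' (ψ z) (fderiv ℝ ψ z u) (fderiv ℝ ψ z v) + fderiv ℝ (fderiv ℝ ψ) z u v := by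
    filter_upwards [hG.isOpen.eventually_mem hy,
      hψ.continuousAt.eventually (hG'.isOpen.eventually_mem hy'), hψ.eventually (by simp),
      h.eventually_nhds] with z h1 h2 h3 h4
    exact leviCivita_of_isometry hG h1 hG' h2 (h3.of_le (by norm_num)) h4
  have hR := curvatureForm_of_affine (hG.eventually_contDiffAt_leviCivita hy).self_of_nhds
    (hG'.eventually_contDiffAt_leviCivita hy').self_of_nhds hψ hc
  let e := LinearEquiv.ofInjectiveEndo _ (fderiv_injective_of_isometry hG hy h.self_of_nhds)
  -- `dψ` conjugates `u ↦ R(u, v) w` to the corresponding endomorphism for `G'`.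
  have hJ : jacobiMap (leviCivita G') (ψ y) (fderiv ℝ ψ y v) (fderiv ℝ ψ y w) =
      e.conj (jacobiMap (leviCivita G) y v w) := by
    ext1 x
    obtain ⟨u, rfl⟩ := e.surjective x
    rw [LinearEquiv.conj_apply]
    simp only [LinearMap.comp_apply, LinearEquiv.coe_coe, LinearEquiv.symm_apply_apply]
    exact (hR u v w).symm
  rw [hG.ricciLocal_eq hy, hG'.ricciLocal_eq hy']
  have h1 := sum_single_eq_trace (jacobiMap (leviCivita G) y v w)
  have h2 := sum_single_eq_trace
    (jacobiMap (leviCivita G') (ψ y) (fderiv ℝ ψ y v) (fderiv ℝ ψ y w))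
  rw [hJ, LinearMap.trace_conj', ← h1, ← hJ] at h2
  exact h2.symm

end Isometry

/-! ### The contracted Bianchi identity -/

section Divergence

variable {m : ℕ} {G : FormField m} {U : Set (Coord m)} {y : Coord m}

/-- The covariant derivative `(∇_u T)(v, w)` of a bilinear form `T` on `ℝᵐ`, for the Levi-Civita
connection of `G`. -/
def covDerivForm (G : FormField m) (T : Coord m → Coord m → Coord m → ℝ) (y u v w : Coord m) : ℝ :=
  fderiv ℝ (fun z ↦ T z v w) y u - T y (leviCivita G y u v) w - T y v (leviCivita G y u w)

/-- The vector `e^a` with the components `g^{ab}`, which is dual to the basis vector `e_a`. -/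
abbrev dualVector (G : FormField m) (y : Coord m) (a : Fin m) : Coord m :=
  sharp G y (EuclideanSpace.proj a)

namespace IsMetricOn

lemma apply_dualVector (hG : IsMetricOn G U) (hy : y ∈ U) (v : Coord m) (a : Fin m) :
    G y v (dualVector G y a) = v a := by
  rw [hG.symm y hy, hG.apply_sharp hy]
  rfl

/-- The contraction `g^{ab} B_ab` is symmetric: `∑ B(e^a, e_a) = ∑ B(e_a, e^a)`. -/
lemma sum_bilin_dualVector_comm (hG : IsMetricOn G U) (hy : y ∈ U)
    (B : Coord m →L[ℝ] Coord m →L[ℝ] ℝ) :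
    ∑ a, B (dualVector G y a) (EuclideanSpace.single a 1) =
      ∑ a, B (EuclideanSpace.single a 1) (dualVector G y a) := by
  have hexp : ∀ x : Coord m, x = ∑ b, x b • EuclideanSpace.single b (1 : ℝ) := by
    intro x
    ext i
    simp [Finset.sum_apply, Pi.single_apply]
  have hs : ∀ a b, dualVector G y a b = dualVector G y b a := fun a b ↦ by
    rw [← hG.apply_dualVector hy, ← hG.apply_dualVector hy, hG.symm y hy]
  have h1 : ∀ a, B (dualVector G y a) (EuclideanSpace.single a 1) =
      ∑ b, dualVector G y a b * B (EuclideanSpace.single b 1) (EuclideanSpace.single a 1) := by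
    intro a
    conv_lhs => rw [hexp (dualVector G y a)]
    simp
  have h2 : ∀ a, B (EuclideanSpace.single a 1) (dualVector G y a) =
      ∑ b, dualVector G y a b * B (EuclideanSpace.single a 1) (EuclideanSpace.single b 1) := by
    intro a
    conv_lhs => rw [hexp (dualVector G y a)]
    simp
  simp only [h1, h2]
  rw [Finset.sum_comm]
  exact Finset.sum_congr rfl fun a _ ↦ Finset.sum_congr rfl fun b _ ↦ by rw [hs]

/-- The covariant derivative of the Ricci tensor is the trace of that of the curvature. -/
lemma covDerivForm_ricciLocal (hG : IsMetricOn G U) (hy : y ∈ U) (u v w : Coord m) :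
    covDerivForm G (ricciLocal G) y u v w =
      ∑ a, covDerivCurvature (leviCivita G) y u (EuclideanSpace.single a 1) v w a := by
  set Γ := leviCivita G with hΓdef
  have hΓ : ContDiffAt ℝ 2 Γ y := (hG.eventually_contDiffAt_leviCivita hy).self_of_nhds
  have hd : fderiv ℝ (fun z ↦ ricciLocal G z v w) y u =
      ∑ a, fderiv ℝ (fun z ↦ curvatureForm Γ z (EuclideanSpace.single a 1) v) y u w a := by
    have h1 : HasFDerivAt (fun z ↦ ∑ a, curvatureForm Γ z (EuclideanSpace.single a 1) v w a)
        _ y := HasFDerivAt.fun_sum fun a _ ↦ (EuclideanSpace.proj a :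
        Coord m →L[ℝ] ℝ).hasFDerivAt.comp y ((differentiableAt_curvatureForm hΓ
          (EuclideanSpace.single a 1) v).hasFDerivAt.clm_apply (hasFDerivAt_const w y))
    have h2 := h1.congr_of_eventuallyEq (f₁ := fun z ↦ ricciLocal G z v w)
      ((hG.isOpen.eventually_mem hy).mono fun z hz ↦ hG.ricciLocal_eq hz v w)
    rw [h2.fderiv]
    simp
  -- `tr ([Γ_u, R(·, v) w])` vanishes.
  have htr : ∑ a, Γ y u (curvatureForm Γ y (EuclideanSpace.single a 1) v w) a =
      ∑ a, curvatureForm Γ y (Γ y u (EuclideanSpace.single a 1)) v w a := by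
    have h1 := sum_single_eq_trace ((Γ y u : Coord m →ₗ[ℝ] Coord m) ∘ₗ jacobiMap Γ y v w)
    have h2 := sum_single_eq_trace (jacobiMap Γ y v w ∘ₗ (Γ y u : Coord m →ₗ[ℝ] Coord m))
    rw [LinearMap.trace_comp_comm', ← h2] at h1
    exact h1
  have hmul : ∀ A B : Coord m →L[ℝ] Coord m, ∀ x, (A * B) x = A (B x) := fun _ _ _ ↦ rfl
  simp only [covDerivForm, hd, hG.ricciLocal_eq hy, ← hΓdef]
  simp only [covDerivCurvature, sub_apply, add_apply, hmul,
    PiLp.sub_apply, PiLp.add_apply, Finset.sum_sub_distrib, Finset.sum_add_distrib, htr]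
  ring

/-- The contracted Bianchi identity `2 div Ric = d (tr Ric)`. -/
theorem contracted_bianchi (hG : IsMetricOn G U) (hy : y ∈ U) (w : Coord m) :
    ∑ a, covDerivForm G (ricciLocal G) y w (EuclideanSpace.single a 1) (dualVector G y a) =
      2 * ∑ a, covDerivForm G (ricciLocal G) y (EuclideanSpace.single a 1) w
        (dualVector G y a) := by
  have hΓ := hG.eventually_contDiffAt_leviCivita hy
  set S := covDerivCurvature (leviCivita G) y
  set e : Fin m → Coord m := fun a ↦ EuclideanSpace.single a 1
  have hcyc : ∀ t u v, S t u v = -S u v t - S v t u := fun t u v ↦ by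
    have := covDerivCurvature_cyclic hΓ.self_of_nhds (hG.leviCivita_symm hy) t u v
    rw [add_assoc, add_eq_zero_iff_eq_neg] at this
    rw [show S t u v = _ from this]; abel
  have hskew : ∀ t u v a b, G y (S t u v a) b = -G y (S t u v b) a := fun t u v a b ↦ by
    rw [hG.symm y hy _ a, eq_neg_iff_add_eq_zero]
    exact metric_covDerivCurvature_skew (hG.eventually_contDiffAt_two hy) hΓ
      (hG.eventually_compatible hy) t u v a b
  have hric : ∀ u v w, covDerivForm G (ricciLocal G) y u v w =
      ∑ a, G y (S u (e a) v w) (dualVector G y a) := fun u v w ↦ by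
    rw [hG.covDerivForm_ricciLocal hy]
    exact Finset.sum_congr rfl fun a _ ↦ (hG.apply_dualVector hy _ a).symm
  -- The Bianchi identity turns the full contraction of `∇_w R` into two equal divergences; in one
  -- of them the last two arguments of `∇R` have to be exchanged.
  have h1 : ∀ a b, G y (S w (e b) (e a) (dualVector G y a)) (dualVector G y b) =
      G y (S (e b) (e a) w (dualVector G y b)) (dualVector G y a)
        + G y (S (e a) (e b) w (dualVector G y a)) (dualVector G y b) := fun a b ↦ by
    have hsw : S (e a) w (e b) = -S (e a) (e b) w := covDerivCurvature_swap y _ _ _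
    rw [hcyc, hsw, sub_neg_eq_add, add_apply, map_add, add_apply, neg_apply, map_neg, neg_apply,
      hskew _ _ _ (dualVector G y a), neg_neg]
  simp only [hric]
  change ∑ a, ∑ b, G y (S w (e b) (e a) (dualVector G y a)) (dualVector G y b) = _
  simp only [h1, Finset.sum_add_distrib]
  rw [Finset.sum_comm, two_mul]

end IsMetricOn

end Divergence

/-! ### The divergence of the first fundamental form -/

section Pullback

variable {m n : ℕ} {G : FormField m} {H : FormField n} {Φ : Coord m → Coord n}
  {U : Set (Coord m)} {V : Set (Coord n)} {y : Coord m}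

/-- The second fundamental form `hessianLocal G H Φ y`, as a bilinear map. -/
def hessianBilin (G : FormField m) (H : FormField n) (Φ : Coord m → Coord n) (y : Coord m) :
    Coord m →L[ℝ] Coord m →L[ℝ] Coord n :=
  fderiv ℝ (fderiv ℝ Φ) y
    - (ContinuousLinearMap.compL ℝ (Coord m) (Coord m) (Coord n) (fderiv ℝ Φ y)).comp
      (leviCivita G y)
    + (leviCivita H (Φ y)).bilinearComp (fderiv ℝ Φ y) (fderiv ℝ Φ y)

lemma hessianBilin_apply (y v w : Coord m) :
    hessianBilin G H Φ y v w = hessianLocal G H Φ y v w := by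
  simp [hessianBilin, hessianLocal, leviCivita_apply]

lemma hessianBilin_symm (hG : IsMetricOn G U) (hy : y ∈ U) (hH : IsMetricOn H V)
    (hΦy : Φ y ∈ V) (hΦ : ContDiffAt ℝ 2 Φ y) (v w : Coord m) :
    hessianBilin G H Φ y v w = hessianBilin G H Φ y w v := by
  simp [hessianBilin, second_fderiv_comm hΦ v w, hG.leviCivita_symm hy v w,
    hH.leviCivita_symm hΦy (fderiv ℝ Φ y v)]

/-- The covariant derivative of the first fundamental form `T = H(dΦ, dΦ)`. -/
lemma covDerivForm_pullback (hH : IsMetricOn H V)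
    (hΦy : Φ y ∈ V) (hΦ : ContDiffAt ℝ 2 Φ y) (u v w : Coord m) :
    covDerivForm G (fun z v w ↦ H (Φ z) (fderiv ℝ Φ z v) (fderiv ℝ Φ z w)) y u v w =
      H (Φ y) (hessianBilin G H Φ y u v) (fderiv ℝ Φ y w)
        + H (Φ y) (fderiv ℝ Φ y v) (hessianBilin G H Φ y u w) := by
  obtain ⟨L, hL, hL'⟩ := hasFDerivAt_pullback hΦ
    ((hH.contDiffAt hΦy).differentiableAt (by simp)) v w
  rw [covDerivForm, hL.fderiv, hL', hH.leviCivita_compatible hΦy]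
  simp [hessianBilin]
  ring

/-- If a multiple of the Ricci tensor is the first fundamental form of `Φ`, then the tension of `Φ`
is orthogonal to the image of `dΦ`: in `2 div T - d (tr T)` with `T = H(dΦ, dΦ)`, only
`2 H(tr ∇dΦ, dΦ)` survives, and for `T = κ Ric` this vanishes by the contracted Bianchi identity. -/
theorem tensionLocal_orthogonal (hG : IsMetricOn G U) (hy : y ∈ U) (hH : IsMetricOn H V)
    (hΦy : Φ y ∈ V) (hΦ : ContDiffAt ℝ 2 Φ y) {κ : ℝ}
    (h : ∀ᶠ z in 𝓝 y, ∀ v w, κ * ricciLocal G z v w =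
      H (Φ z) (fderiv ℝ Φ z v) (fderiv ℝ Φ z w)) (w : Coord m) :
    H (Φ y) (tensionLocal G H Φ y) (fderiv ℝ Φ y w) = 0 := by
  set T : Coord m → Coord m → Coord m → ℝ :=
    fun z v w ↦ H (Φ z) (fderiv ℝ Φ z v) (fderiv ℝ Φ z w)
  set e : Fin m → Coord m := fun a ↦ EuclideanSpace.single a 1
  have hT : ∀ u v w, covDerivForm G T y u v w = κ * covDerivForm G (ricciLocal G) y u v w := by
    intro u v w
    have h1 : (fun z ↦ T z v w) =ᶠ[𝓝 y] fun z ↦ κ * ricciLocal G z v w :=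
      h.mono fun z hz ↦ (hz v w).symm
    have h2 := h.self_of_nhds
    simp only [covDerivForm, h1.fderiv_eq]
    have h3 : fderiv ℝ (fun z ↦ κ * ricciLocal G z v w) y u =
        κ * fderiv ℝ (fun z ↦ ricciLocal G z v w) y u :=
      DFunLike.congr_fun (congrFun
        (fderiv_const_smul_field (𝕜 := ℝ) (f := fun z ↦ ricciLocal G z v w) κ) y) u
    simp only [h3, T, ← h2]
    ring
  have hbianchi : ∑ a, covDerivForm G T y w (e a) (dualVector G y a) =
      2 * ∑ a, covDerivForm G T y (e a) w (dualVector G y a) := by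
    simp only [hT, ← Finset.mul_sum]
    rw [hG.contracted_bianchi hy w]
    ring
  have hcov : ∀ u v w, covDerivForm G T y u v w =
      H (Φ y) (hessianBilin G H Φ y u v) (fderiv ℝ Φ y w)
        + H (Φ y) (fderiv ℝ Φ y v) (hessianBilin G H Φ y u w) :=
    covDerivForm_pullback hH hΦy hΦ
  -- The two terms of `d (tr T)` agree, and each is one of the terms of `div T`.
  have hcomm := hG.sum_bilin_dualVector_comm hy
    ((H (Φ y)).bilinearComp (hessianBilin G H Φ y w) (fderiv ℝ Φ y))
  simp only [ContinuousLinearMap.bilinearComp_apply] at hcomm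
  have htens : H (Φ y) (tensionLocal G H Φ y) (fderiv ℝ Φ y w) =
      ∑ a, H (Φ y) (fderiv ℝ Φ y w) (hessianBilin G H Φ y (e a) (dualVector G y a)) := by
    rw [hH.symm _ hΦy, tensionLocal, map_sum]
    simp only [hessianBilin_apply]
    rfl
  rw [htens]
  simp only [hcov, Finset.sum_add_distrib] at hbianchi
  simp only [fun a ↦ hH.symm _ hΦy (fderiv ℝ Φ y (e a)),
    fun a ↦ hessianBilin_symm hG hy hH hΦy hΦ (e a) w] at hbianchi
  rw [hcomm] at hbianchi
  linarith

end Pullback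

/-! ### Metrics in charts -/

section Charts

variable {m : ℕ} {X : Type*} [TopologicalSpace X]
  [ChartedSpace (EuclideanSpace ℝ (Fin m)) X] [IsManifold (𝓡 m) ∞ X]

lemma mdifferentiableAt_extChartAt_symm {p : X} {y : Coord m}
    (hy : y ∈ (extChartAt (𝓡 m) p).target) :
    MDifferentiableAt (𝓡 m) (𝓡 m) (extChartAt (𝓡 m) p).symm y := by
  have h := mdifferentiableWithinAt_extChartAt_symm (I := 𝓡 m) hy
  rwa [ModelWithCorners.range_eq_univ, mdifferentiableWithinAt_univ] at h

lemma isInvertible_mfderiv_extChartAt_symm {p : X} {y : Coord m}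
    (hy : y ∈ (extChartAt (𝓡 m) p).target) :
    (mfderiv (𝓡 m) (𝓡 m) (extChartAt (𝓡 m) p).symm y).IsInvertible := by
  have h := isInvertible_mfderivWithin_extChartAt_symm (I := 𝓡 m) hy
  rwa [ModelWithCorners.range_eq_univ, mfderivWithin_univ] at h

lemma mfderiv_extChartAt_symm_self (p : X) :
    mfderiv (𝓡 m) (𝓡 m) (extChartAt (𝓡 m) p).symm (extChartAt (𝓡 m) p p) =
      ContinuousLinearMap.id ℝ (Coord m) := by
  have h := mfderivWithin_range_extChartAt_symm (I := 𝓡 m) (x := p)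
  rwa [ModelWithCorners.range_eq_univ, mfderivWithin_univ] at h

/-- The coordinate vector fields of a chart are smooth. -/
lemma contMDiffOn_coordinateField (p : X) (v : Coord m) :
    ContMDiffOn (𝓡 m) ((𝓡 m).prod (𝓡 m)) ∞
      (fun y : Coord m ↦ TotalSpace.mk' (Coord m) (E := fun x : X ↦ TangentSpace (𝓡 m) x)
        ((extChartAt (𝓡 m) p).symm y)
        (mfderiv (𝓡 m) (𝓡 m) (extChartAt (𝓡 m) p).symm y v))
      (extChartAt (𝓡 m) p).target := by
  have h1 := (trivializationAt (Coord m) (TangentSpace (𝓡 m)) p).contMDiffOn_symm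
    (IB := 𝓡 m) (n := ∞)
  have h2 : ContMDiffOn (𝓡 m) ((𝓡 m).prod (𝓡 m)) ∞
      (fun y : Coord m ↦ ((extChartAt (𝓡 m) p).symm y, v)) (extChartAt (𝓡 m) p).target :=
    (contMDiffOn_extChartAt_symm p).prodMk contMDiffOn_const
  have hmem : ∀ y ∈ (extChartAt (𝓡 m) p).target,
      (extChartAt (𝓡 m) p).symm y ∈ (chartAt (Coord m) p).source := fun y hy ↦ by
    rw [← extChartAt_source (𝓡 m)]
    exact (extChartAt (𝓡 m) p).map_target hy
  have h3 := h1.comp h2 fun y hy ↦ by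
    rw [Set.mem_preimage, Trivialization.mem_target]
    exact hmem y hy
  refine h3.congr fun y hy ↦ ?_
  have h4 := TangentBundle.symmL_trivializationAt (I := 𝓡 m) (hmem y hy)
  rw [ModelWithCorners.range_eq_univ, mfderivWithin_univ,
    (extChartAt (𝓡 m) p).right_inv hy] at h4
  have h5 : mfderiv (𝓡 m) (𝓡 m) (extChartAt (𝓡 m) p).symm y v =
      (trivializationAt (Coord m) (TangentSpace (𝓡 m)) p).symm ((extChartAt (𝓡 m) p).symm y) v :=
    (DFunLike.congr_fun h4 v).symm.trans
      ((trivializationAt (Coord m) (TangentSpace (𝓡 m)) p).symmL_apply (R := ℝ) (hmem y hy) v)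
  exact (congrArg (TotalSpace.mk' (Coord m) _) h5).trans
    ((trivializationAt (Coord m) (TangentSpace (𝓡 m)) p).mk_symm (hmem y hy) v)

namespace PseudoRiemannianMetric

variable (g : PseudoRiemannianMetric m X)

lemma inChart_apply (p : X) (y v w : Coord m) : g.inChart p y v w =
    g.val ((extChartAt (𝓡 m) p).symm y)
      (mfderiv (𝓡 m) (𝓡 m) (extChartAt (𝓡 m) p).symm y v)
      (mfderiv (𝓡 m) (𝓡 m) (extChartAt (𝓡 m) p).symm y w) := rfl

lemma val_eq_of_eq {p q : X} (h : p = q) (v w : Coord m) :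
    g.val p v w = g.val q v w := by subst h; rfl

lemma contDiffOn_inChart (p : X) :
    ContDiffOn ℝ ∞ (g.inChart p) (extChartAt (𝓡 m) p).target := by
  -- In finite dimensions, it is enough to consider the components `g(∂_v, ∂_w)`.
  rw [contDiffOn_clm_apply]
  intro v
  rw [contDiffOn_clm_apply]
  intro w
  rw [← contMDiffOn_iff_contDiffOn]
  intro y hy
  have h : ContMDiffWithinAt (𝓡 m) ((𝓡 m).prod 𝓘(ℝ)) ∞
      (fun y ↦ TotalSpace.mk' ℝ (E := Bundle.Trivial X ℝ) ((extChartAt (𝓡 m) p).symm y)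
        (g.val ((extChartAt (𝓡 m) p).symm y)
          (mfderiv (𝓡 m) (𝓡 m) (extChartAt (𝓡 m) p).symm y v)
          (mfderiv (𝓡 m) (𝓡 m) (extChartAt (𝓡 m) p).symm y w)))
      (extChartAt (𝓡 m) p).target y := by
    apply ContMDiffWithinAt.clm_bundle_apply₂ (F₁ := Coord m) (F₂ := Coord m)
    · exact g.contMDiff.contMDiffAt.comp_contMDiffWithinAt y (contMDiffOn_extChartAt_symm p y hy)
    · exact contMDiffOn_coordinateField p v y hy
    · exact contMDiffOn_coordinateField p w y hy
  simp only [contMDiffWithinAt_totalSpace] at h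
  exact h.2

lemma isMetricOn_inChart (p : X) : IsMetricOn (g.inChart p) (extChartAt (𝓡 m) p).target where
  isOpen := isOpen_extChartAt_target p
  contDiffOn := g.contDiffOn_inChart p
  symm _ _ _ _ := g.symm _ _ _
  nondegenerate y hy v hv := by
    have hA : Function.Bijective (mfderiv (𝓡 m) (𝓡 m) (extChartAt (𝓡 m) p).symm y) := by
      obtain ⟨e, he⟩ := isInvertible_mfderiv_extChartAt_symm hy
      exact he ▸ e.bijective
    have h : mfderiv (𝓡 m) (𝓡 m) (extChartAt (𝓡 m) p).symm y v = 0 :=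
      g.nondegenerate _ _ fun w ↦ by
        obtain ⟨w, rfl⟩ := hA.2 w
        exact hv w
    exact hA.1 (h.trans (map_zero _).symm)

/-- The preferred chart around `p` identifies the tangent space at `p` with `ℝᵐ`. -/
lemma inChart_self (p : X) (v w : Coord m) :
    g.inChart p (extChartAt (𝓡 m) p p) v w = g.val p v w := by
  rw [inChart_apply, mfderiv_extChartAt_symm_self]
  exact g.val_eq_of_eq (extChartAt_to_inv p) v w

/-- If `ψ` is the coordinate expression of `f : ℝᵏ → X` in the chart around `p`, then the pull-back
of `g` under `f` can be computed as the pull-back of `g.inChart p` under `ψ`. -/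
lemma inChart_pullback {k : ℕ} (p : X) {f : Coord k → X} {ψ : Coord k → Coord m} {z : Coord k}
    (hψ : DifferentiableAt ℝ ψ z) (hz : ψ z ∈ (extChartAt (𝓡 m) p).target)
    (hf : f =ᶠ[𝓝 z] (extChartAt (𝓡 m) p).symm ∘ ψ) (v w : Coord k) :
    g.inChart p (ψ z) (fderiv ℝ ψ z v) (fderiv ℝ ψ z w) =
      g.val (f z) (mfderiv (𝓡 k) (𝓡 m) f z v) (mfderiv (𝓡 k) (𝓡 m) f z w) := by
  have h : ∀ u : Coord k, mfderiv (𝓡 k) (𝓡 m) f z u =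
      mfderiv (𝓡 m) (𝓡 m) (extChartAt (𝓡 m) p).symm (ψ z) (fderiv ℝ ψ z u) := fun u ↦ by
    rw [hf.mfderiv_eq, mfderiv_comp z (mdifferentiableAt_extChartAt_symm hz)
      hψ.mdifferentiableAt, mfderiv_eq_fderiv]
    rfl
  rw [inChart_apply, h, h]
  exact g.val_eq_of_eq hf.eq_of_nhds.symm _ _

end PseudoRiemannianMetric
end Charts

/-! ### Tensoriality of the Ricci curvature and the Einstein equation -/

section Maps

variable {m n : ℕ} {X : Type*} [TopologicalSpace X]
  [ChartedSpace (EuclideanSpace ℝ (Fin m)) X] [IsManifold (𝓡 m) ∞ X]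
  {Y : Type*} [TopologicalSpace Y]
  [ChartedSpace (EuclideanSpace ℝ (Fin n)) Y] [IsManifold (𝓡 n) ∞ Y]
  {g : PseudoRiemannianMetric m X} {h : PseudoRiemannianMetric n Y} {φ : X → Y} {κ : ℝ}

/-- The Ricci tensor does not depend on the chart: in the chart around `p`, its components at `z`
are the values of `g.ricci` on the coordinate vectors at `z`. -/
lemma ricciLocal_inChart (g : PseudoRiemannianMetric m X) (p : X) {z : Coord m}
    (hz : z ∈ (extChartAt (𝓡 m) p).target) (v w : Coord m) :
    ricciLocal (g.inChart p) z v w = g.ricci ((extChartAt (𝓡 m) p).symm z)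
      (mfderiv (𝓡 m) (𝓡 m) (extChartAt (𝓡 m) p).symm z v)
      (mfderiv (𝓡 m) (𝓡 m) (extChartAt (𝓡 m) p).symm z w) := by
  set q := (extChartAt (𝓡 m) p).symm z
  set ψ : Coord m → Coord m := extChartAt (𝓡 m) q ∘ (extChartAt (𝓡 m) p).symm
  have htarget : ∀ᶠ z' in 𝓝 z, z' ∈ (extChartAt (𝓡 m) p).target :=
    (isOpen_extChartAt_target p).mem_nhds hz
  have hcont : ContinuousAt (extChartAt (𝓡 m) p).symm z :=
    (mdifferentiableAt_extChartAt_symm hz).continuousAt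
  have hsource : ∀ᶠ z' in 𝓝 z, (extChartAt (𝓡 m) p).symm z' ∈ (extChartAt (𝓡 m) q).source :=
    hcont.eventually (extChartAt_source_mem_nhds (I := 𝓡 m) q)
  have hψ : ContDiffAt ℝ ∞ ψ z := by
    rw [← contMDiffAt_iff_contDiffAt]
    exact ContMDiffAt.comp z contMDiffAt_extChartAt
      ((contMDiffOn_extChartAt_symm p).contMDiffAt htarget)
  have hψz : ψ z = extChartAt (𝓡 m) q q := rfl
  have hψ3 : ContDiffAt ℝ 3 ψ z := hψ.of_le ENat.LEInfty.out
  have hiso : ∀ᶠ z' in 𝓝 z, ∀ v w, g.inChart p z' v w =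
      g.inChart q (ψ z') (fderiv ℝ ψ z' v) (fderiv ℝ ψ z' w) := by
    filter_upwards [htarget, hsource.eventually_nhds, hψ3.eventually (by simp)] with z' h1 h2 h3 v w
    rw [g.inChart_apply]
    refine (g.inChart_pullback q (h3.differentiableAt (by simp))
      ((extChartAt (𝓡 m) q).map_source h2.self_of_nhds) ?_ v w).symm
    filter_upwards [h2] with z'' h4
    exact ((extChartAt (𝓡 m) q).left_inv h4).symm
  -- The differential of the chart around `q` at `q` itself is the identity.
  have hd : ∀ v, fderiv ℝ ψ z v = mfderiv (𝓡 m) (𝓡 m) (extChartAt (𝓡 m) p).symm z v := by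
    intro v
    have h1 := mfderiv_comp z (mdifferentiableAt_extChartAt (I := 𝓡 m) (mem_chart_source _ q))
      (mdifferentiableAt_extChartAt_symm hz)
    have h2 := DFunLike.congr_fun (mfderiv_extChartAt_self (I := 𝓡 m) (x := q))
      (mfderiv (𝓡 m) (𝓡 m) (extChartAt (𝓡 m) p).symm z v)
    rw [← mfderiv_eq_fderiv]
    exact (DFunLike.congr_fun h1 v).trans h2
  rw [ricciLocal_of_isometry (g.isMetricOn_inChart p) hz (g.isMetricOn_inChart q)
    (hψz ▸ mem_extChartAt_target q) hψ3 hiso, hd, hd]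
  rfl

/-- The Einstein equation holds, as an equation between local expressions, on a neighbourhood in the
preferred charts around `x` and `φ x`. -/
lemma EinsteinEquation.inChart (hE : EinsteinEquation κ g h φ) (hφ : ContMDiff (𝓡 m) (𝓡 n) ∞ φ)
    (x : X) : ∀ᶠ z in 𝓝 (extChartAt (𝓡 m) x x), ∀ v w,
      κ * ricciLocal (g.inChart x) z v w =
        h.inChart (φ x) (writtenInExtChartAt (𝓡 m) (𝓡 n) x φ z)
          (fderiv ℝ (writtenInExtChartAt (𝓡 m) (𝓡 n) x φ) z v)
          (fderiv ℝ (writtenInExtChartAt (𝓡 m) (𝓡 n) x φ) z w) := by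
  set Φ := writtenInExtChartAt (𝓡 m) (𝓡 n) x φ
  have htarget : ∀ᶠ z in 𝓝 (extChartAt (𝓡 m) x x), z ∈ (extChartAt (𝓡 m) x).target :=
    extChartAt_target_mem_nhds x
  have hsource : ∀ᶠ z in 𝓝 (extChartAt (𝓡 m) x x),
      φ ((extChartAt (𝓡 m) x).symm z) ∈ (extChartAt (𝓡 n) (φ x)).source := by
    have hc : ContinuousAt (φ ∘ (extChartAt (𝓡 m) x).symm) (extChartAt (𝓡 m) x x) :=
      hφ.continuous.continuousAt.comp (continuousAt_extChartAt_symm x)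
    refine hc.eventually ?_
    rw [Function.comp_apply, extChartAt_to_inv]
    exact extChartAt_source_mem_nhds (φ x)
  filter_upwards [htarget, hsource.eventually_nhds] with z h1 h2 v w
  have hdφ : MDifferentiableAt (𝓡 m) (𝓡 n) φ ((extChartAt (𝓡 m) x).symm z) :=
    hφ.mdifferentiable (by simp) _
  have hdsymm := mdifferentiableAt_extChartAt_symm h1
  have hΦd : DifferentiableAt ℝ Φ z := by
    rw [← mdifferentiableAt_iff_differentiableAt]
    refine MDifferentiableAt.comp z (mdifferentiableAt_extChartAt ?_) (hdφ.comp z hdsymm)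
    rw [← extChartAt_source (𝓡 n)]
    exact h2.self_of_nhds
  rw [ricciLocal_inChart g x h1, hE, firstFundamentalForm,
    h.inChart_pullback (φ x) (f := φ ∘ (extChartAt (𝓡 m) x).symm) hΦd
      ((extChartAt (𝓡 n) (φ x)).map_source h2.self_of_nhds) ?_,
    mfderiv_comp z hdφ hdsymm]
  · rfl
  · filter_upwards [h2] with z' h3
    exact ((extChartAt (𝓡 n) (φ x)).left_inv h3).symm

/-- The Einstein equation implies `h(tr(∇dφ), dφ) = 0`. -/
theorem EinsteinEquation.tensionOrthogonal (hE : EinsteinEquation κ g h φ)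
    (hφ : ContMDiff (𝓡 m) (𝓡 n) ∞ φ) : TensionOrthogonal g h φ := by
  intro x v
  set Φ := writtenInExtChartAt (𝓡 m) (𝓡 n) x φ with hΦ
  have hΦx : Φ (extChartAt (𝓡 m) x x) = extChartAt (𝓡 n) (φ x) (φ x) := by
    simp [hΦ, writtenInExtChartAt]
  have hsmooth : ContDiffAt ℝ 2 Φ (extChartAt (𝓡 m) x x) := by
    have h1 := ((contMDiffAt_iff (I := 𝓡 m) (I' := 𝓡 n)).1 (hφ x)).2
    rw [ModelWithCorners.range_eq_univ, contDiffWithinAt_univ] at h1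
    exact h1.of_le ENat.LEInfty.out
  have hd : mfderiv (𝓡 m) (𝓡 n) φ x = fderiv ℝ Φ (extChartAt (𝓡 m) x x) := by
    rw [(hφ.mdifferentiable (by simp) x).mfderiv, ModelWithCorners.range_eq_univ,
      fderivWithin_univ]
  have key := tensionLocal_orthogonal (g.isMetricOn_inChart x) (mem_extChartAt_target x)
    (h.isMetricOn_inChart (φ x)) (hΦx ▸ mem_extChartAt_target (φ x)) hsmooth (hE.inChart hφ x) v
  rw [hΦx, h.inChart_self] at key
  rw [hd]
  exact key

/-- Nondegeneracy of `h` upgrades orthogonality to the image of a surjective `dφ`. -/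
theorem TensionOrthogonal.tension_eq_zero (hT : TensionOrthogonal g h φ)
    (hφ : IsSubmersive m n φ) (x : X) : tension g h φ x = 0 := by
  refine h.nondegenerate _ _ fun w ↦ ?_
  obtain ⟨v, rfl⟩ := hφ x w
  exact hT x v

end Maps

end EinsteinMap

end

theorem proposition5p5 {m n : ℕ} (hm : 3 ≤ m) (hn : 1 ≤ n)
    {X : Type*} [TopologicalSpace X] [ChartedSpace (EuclideanSpace ℝ (Fin m)) X]
    [IsManifold (𝓡 m) ∞ X]
    {Y : Type*} [TopologicalSpace Y] [ChartedSpace (EuclideanSpace ℝ (Fin n)) Y]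
    [IsManifold (𝓡 n) ∞ Y]
    (g : EinsteinMap.PseudoRiemannianMetric m X) (h : EinsteinMap.PseudoRiemannianMetric n Y)
    (φ : X → Y) (hφ : ContMDiff (𝓡 m) (𝓡 n) ∞ φ) (κ : ℝ) (hκ : κ ≠ 0) :
    (EinsteinMap.EinsteinEquation κ g h φ → EinsteinMap.TensionOrthogonal g h φ) ∧
    (EinsteinMap.IsSubmersive m n φ → EinsteinMap.TensionOrthogonal g h φ →
      ∀ x, EinsteinMap.tension g h φ x = 0) ∧
    (EinsteinMap.IsSubmersive m n φ → EinsteinMap.EinsteinEquation κ g h φ →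
      (∀ x, EinsteinMap.tension g h φ x = 0) ∧
      (g.IsRiemannian → h.IsRiemannian → EinsteinMap.IsHarmonicMap g h φ) ∧
      (g.IsLorentzian → h.IsRiemannian → EinsteinMap.IsWaveMap g h φ)) := by
  have h1 : EinsteinMap.EinsteinEquation κ g h φ → EinsteinMap.TensionOrthogonal g h φ :=
    fun hE ↦ hE.tensionOrthogonal hφ
  have h2 : EinsteinMap.IsSubmersive m n φ → EinsteinMap.TensionOrthogonal g h φ →
      ∀ x, EinsteinMap.tension g h φ x = 0 := fun hs hT ↦ hT.tension_eq_zero hs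
  exact ⟨h1, h2, fun hs hE ↦ ⟨h2 hs (h1 hE), fun hg hh ↦ ⟨hg, hh, hφ, h2 hs (h1 hE)⟩,
    fun hg hh ↦ ⟨hg, hh, hφ, h2 hs (h1 hE)⟩⟩⟩
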